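/- Let $P$ be a polynomial with coefficients in $\mathbb{N}_0$. There is a constant $K$, depending only on $P$, such that the following holds for every $C\ge 1$ and every arbdefect vector $\vec d=(d_1,\dots,d_C)\in\mathbb{N}_0^C$. There is a deterministic algorithm in the $\mathsf{LOCAL}$ model that, on every finite simple graph $G=(V,E)$ with $n$ nodes and maximum degree $\Delta$ for which $\vec d$ is $1$-relaxed, i.e. $\sum_{i=1}^{C}(d_i+1)>\Delta$, for every assignment of unique identifiers from $\{1,\dots,P(n)\}$ to the nodes and for every port numbering, terminates at all nodes within $K\cdot(\Delta+\log^* n)=O(\Delta+\log^* n)$ rounds and computes a $\vec d$-arbdefective $C$-coloring of $G$: a coloring $\varphi:V\to\{1,\dots,C\}$ together with an orientation of the edges $E$ such that every node $v$ has at most $d_{\varphi(v)}$ outneighbors of color $\varphi(v)$. Here, in the $\mathsf{LOCAL}$ model all nodes execute the same algorithm in synchronous rounds; initially a node knows only $n$, $\Delta$, its own degree and its own identifier; in each round it exchanges messages of unbounded size with its neighbors (addressed through local port numbers) and performs unbounded local computation; at termination it outputs its color and the orientation of its incident edges. $\log^* x$ is the number of times $\log_2$ has to be applied to $x$ until the result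 is at most $1$. -/

import Mathlib

/-! ### Generalized arbdefective colorings -/

/-- An orientation of the edges of `G`: `Out u v` says that the edge `{u, v}` is directed
from `u` to `v`, i.e. that `v` is an outneighbor of `u`. -/
structure EdgeOrientation {V : Type*} (G : SimpleGraph V) where
  Out : V → V → Prop
  adj_of_out : ∀ {u v : V}, Out u v → G.Adj u v
  xor_of_adj : ∀ {u v : V}, G.Adj u v → Xor (Out u v) (Out v u)

/-- `φ` is a `d`-arbdefective coloring with respect to the orientation `O`: every node `v`
has at most `d (φ v)` outneighbors of its own color `φ v`. The arbdefect vector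
of length `c` is `d : Fin c → ℕ`. -/
def IsArbdefectiveColoring {V : Type*} {G : SimpleGraph V} {c : ℕ} (d : Fin c → ℕ)
    (O : EdgeOrientation G) (φ : V → Fin c) : Prop :=
  ∀ v : V, {u : V | O.Out v u ∧ φ u = φ v}.ncard ≤ d (φ v)

/-- The capacity of an arbdefect vector. -/
def arbdefectCapacity {c : ℕ} (d : Fin c → ℕ) : ℕ := ∑ i, (d i + 1)

/-- The arbdefect vector `d` is `σ`-relaxed (for graphs of maximum degree `Δ`). -/
def IsRelaxed (σ : ℝ) (Δ : ℕ) {c : ℕ} (d : Fin c → ℕ) : Prop :=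
  σ * (Δ : ℝ) < (arbdefectCapacity d : ℝ)

/-! ### The deterministic `LOCAL` model -/

/-- A port numbering: every node `v` numbers its incident edges (equivalently, its
neighbors) by `Fin (deg v)`, in an arbitrary way. -/
abbrev PortNumbering {V : Type*} [Fintype V] (G : SimpleGraph V) [DecidableRel G.Adj] :=
  ∀ v : V, Fin (G.degree v) ≃ G.neighborSet v

/-- A deterministic algorithm in the `LOCAL` model, executed by all nodes alike, in which a
node of degree `deg` has to produce an output in `Out deg`. Initially, a node knows only the
number `n` of nodes, the maximum degree `Δ`, its own degree and its own identifier. In every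
round it sends one message through each of its ports, receives one message (or nothing)
through each of its ports, and updates its state. It terminates as soon as
`output` returns a value. Messages and local computation are unrestricted. -/
structure LocalAlgorithm (Out : ℕ → Type) where
  State : ℕ → Type
  Msg : Type
  init : (n Δ deg ident : ℕ) → State deg
  send : {deg : ℕ} → State deg → Fin deg → Msg
  receive : {deg : ℕ} → State deg → (Fin deg → Option Msg) → State deg
  output : {deg : ℕ} → State deg → Option (Out deg)

namespace LocalAlgorithm

variable {Out : ℕ → Type} (A : LocalAlgorithm Out)

/-- What a node in state `s` transmits through port `i`: a node that
has terminated no longer sends anything. -/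
def transmit {deg : ℕ} (s : A.State deg) (i : Fin deg) : Option A.Msg :=
  if (A.output s).isSome then none else some (A.send s i)

/-- The next state of a node: a node that has terminated keeps its state. -/
def update {deg : ℕ} (s : A.State deg) (m : Fin deg → Option A.Msg) : A.State deg :=
  if (A.output s).isSome then s else A.receive s m

/-- The states of all nodes after `t` synchronous rounds on `G`, with identifiers `ident` and
port numbering `ports`. What `v` receives through port `i` is what the neighbor `u` behind
that port transmits through its own port leading to `v`. -/
def run {V : Type*} [Fintype V] (G : SimpleGraph V) [DecidableRel G.Adj]
    (ident : V → ℕ) (ports : PortNumbering G) : ℕ → (v : V) → A.State (G.degree v)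
  | 0, v => A.init (Fintype.card V) G.maxDegree (G.degree v) (ident v)
  | t + 1, v => A.update (run G ident ports t v) fun i =>
      A.transmit (run G ident ports t (ports v i))
        ((ports (ports v i)).symm ⟨v, ((ports v i).2 : G.Adj v (ports v i)).symm⟩)

/-- On `G`, with identifiers `ident` and port numbering `ports`, all nodes have terminated
after at most `T` rounds, and their outputs together form a correct solution. -/
def SolvesWithin {V : Type*} [Fintype V] (G : SimpleGraph V) [DecidableRel G.Adj]
    (ident : V → ℕ) (ports : PortNumbering G)
    (Correct : ((v : V) → Out (G.degree v)) → Prop) (T : ℕ) : Prop :=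
  ∃ out : (v : V) → Out (G.degree v),
    (∀ v, A.output (A.run G ident ports T v) = some (out v)) ∧ Correct out

end LocalAlgorithm

/-- The local output of a node of degree `deg`: its color, and for each of its ports whether
the edge behind that port is directed away from the node. -/
structure ArbdefectiveOutput (c deg : ℕ) where
  color : Fin c
  outgoing : Fin deg → Bool

/-- The local outputs form a `d`-arbdefective coloring together with a corresponding
orientation of the edges (on which the two endpoints of every edge agree). -/
def IsArbdefectiveSolution {V : Type*} [Fintype V] (G : SimpleGraph V) [DecidableRel G.Adj]
    (ports : PortNumbering G) {c : ℕ} (d : Fin c → ℕ)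
    (out : (v : V) → ArbdefectiveOutput c (G.degree v)) : Prop :=
  ∃ O : EdgeOrientation G,
    (∀ (v : V) (i : Fin (G.degree v)), (out v).outgoing i = true ↔ O.Out v (ports v i)) ∧
    IsArbdefectiveColoring d O fun v => (out v).color

/-- Unique identifiers in `{1, …, N}`. -/
def IsIdentAssignment {V : Type*} (N : ℕ) (ident : V → ℕ) : Prop :=
  Function.Injective ident ∧ ∀ v, ident v ∈ Set.Icc 1 N

/-! ### The iterated logarithm -/

/-- `log* x`: how often the binary logarithm has to be applied to `x` until the
result is at most `1`. -/
noncomputable def logStar (x : ℝ) : ℕ := sInf {k : ℕ | (Real.logb 2)^[k] x ≤ 1}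

/-- The set in the definition of `logStar` is never empty. -/
theorem logStar_set_nonempty (x : ℝ) : {k : ℕ | (Real.logb 2)^[k] x ≤ 1}.Nonempty := by
  have key : ∀ (m : ℕ) (y : ℝ), y ≤ m + 1 → ∃ k : ℕ, (Real.logb 2)^[k] y ≤ 1 := by
    intro m
    induction m with
    | zero => intro y hy; exact ⟨0, by simpa using hy⟩
    | succ m ih =>
      intro y hy
      by_cases h1 : y ≤ 1
      · exact ⟨0, by simpa using h1⟩
      · have hy0 : 0 < y := by linarith
        have hle : Real.logb 2 y ≤ m + 1 := by
          rw [Real.logb_le_iff_le_rpow (by norm_num) hy0]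
          have h2 : (m + 2 : ℕ) ≤ 2 ^ (m + 1) := Nat.lt_two_pow_self (n := m + 1)
          have h3 : ((m + 2 : ℕ) : ℝ) ≤ ((2 ^ (m + 1) : ℕ) : ℝ) := by exact_mod_cast h2
          have h4 : (2 : ℝ) ^ ((m : ℝ) + 1) = ((2 ^ (m + 1) : ℕ) : ℝ) := by
            have h5 : ((m : ℝ) + 1) = ((m + 1 : ℕ) : ℝ) := by push_cast; ring
            rw [h5, Real.rpow_natCast]; push_cast; ring
          rw [h4]
          push_cast at hy h3 ⊢
          linarith
        obtain ⟨k, hk⟩ := ih _ hle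
        exact ⟨k + 1, by simpa [Function.iterate_succ_apply] using hk⟩
  obtain ⟨m, hm⟩ := exists_nat_ge x
  exact key m x (by linarith)

/-! Given a proper coloring with O(Δ) colors, a greedy sweep suffices: the color classes act one
after another, and edges point to the endpoint that acted earlier. If every arbdefect color `i`
occurred at least `d i + 1` times among the earlier neighbors of a node, its degree would be at
least `∑ i, (d i + 1) > Δ`; so an admissible color always exists (`exists_card_filter_le`,
`greedyRun_card_le`).

The proper coloring comes from the identifiers. Two steps of Linial's polynomial reduction
(`colorReduces_sq_of_prime`) replace `2 ^ A` colors by `max A ((10 * Δ) ^ 11)` for large `A`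
(`colorReduces_log`), so O(log* n) rounds reach `(10 * Δ) ^ 11` colors. One more step leaves q²
colors for a prime q in (10Δ, 20Δ], and q rounds of the additive-group reduction leave q colors
(`additiveGroupRun_lt`). The rounds depend only on P, d, n and Δ, so every node knows them in
advance. -/

/-! ### Synchronous rounds -/

/-- One round of an anonymous algorithm: the new state of a node as a function of its state and
of the states of its neighbors. -/
abbrev Round (S : Type) := S → Multiset S → S

section Rounds

variable {S : Type} {V : Type*} [Fintype V] (G : SimpleGraph V) [DecidableRel G.Adj]

/-- The states of all nodes after one round. -/
def applyRound (x : V → S) (f : Round S) : V → S :=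
  fun v => f (x v) ((G.neighborFinset v).val.map x)

/-- The states of all nodes after a list of rounds. -/
def runRounds (l : List (Round S)) (x : V → S) : V → S :=
  l.foldl (applyRound G) x

theorem runRounds_append (l l' : List (Round S)) (x : V → S) :
    runRounds G (l ++ l') x = runRounds G l' (runRounds G l x) := by
  simp [runRounds]

theorem runRounds_concat (l : List (Round S)) (f : Round S) (x : V → S) :
    runRounds G (l ++ [f]) x = applyRound G (runRounds G l x) f := by
  simp [runRounds]

theorem runRounds_cons (l : List (Round S)) (f : Round S) (x : V → S) :
    runRounds G (f :: l) x = runRounds G l (applyRound G x f) := rfl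

/-- A round on the first component of a pair. -/
def Round.onFst {S' : Type} (f : Round S) : Round (S × S') :=
  fun s N => (f s.1 (N.map Prod.fst), s.2)

/-- Lets the color reduction run on states that also carry an arbdefect color for the later sweep.
-/
theorem runRounds_onFst {S' : Type} (l : List (Round S)) (x : V → S × S') :
    Prod.fst ∘ runRounds G (l.map Round.onFst) x = runRounds G l (Prod.fst ∘ x) := by
  induction l generalizing x with
  | nil => rfl
  | cons f l ih =>
    rw [List.map_cons, runRounds_cons, runRounds_cons, ih]
    congr 1
    ext v
    simp [applyRound, Round.onFst]

end Rounds

/-! ### Executing a list of rounds in the LOCAL model -/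

/-- The algorithm that executes the rounds `rounds n Δ`, then
lets all nodes learn the states of their neighbors, and terminates. If `Δ = 0` it terminates
immediately. -/
def roundAlgorithm {Out : ℕ → Type} {S : Type} (start : ℕ → S)
    (rounds : ℕ → ℕ → List (Round S)) (out : (deg : ℕ) → S → (Fin deg → S) → Out deg) :
    LocalAlgorithm Out where
  State deg := List (Round S) × S × Option (Fin deg → S)
  Msg := S
  init n Δ _ ident :=
    (rounds n Δ, start ident, if Δ = 0 then some fun _ => start ident else none)
  send s _ := s.2.1
  receive s m :=
    match s.1 with
    | [] => ([], s.2.1, some fun i => (m i).getD s.2.1)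
    | f :: l => (l, f s.2.1 (Finset.univ.val.map fun i => (m i).getD s.2.1), none)
  output s := s.2.2.map (out _ s.2.1)

namespace LocalAlgorithm

variable {Out : ℕ → Type} (A : LocalAlgorithm Out) {V : Type*} [Fintype V]
  (G : SimpleGraph V) [DecidableRel G.Adj] (ident : V → ℕ) (ports : PortNumbering G)

theorem output_run_of_le {t t' : ℕ} (h : t ≤ t') {v : V} {o : Out (G.degree v)}
    (ho : A.output (A.run G ident ports t v) = some o) :
    A.output (A.run G ident ports t' v) = some o := by
  induction t', h using Nat.le_induction with
  | base => exact ho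
  | succ t' _ ih => simp [run, update, ih]

end LocalAlgorithm

section RoundAlgorithm

variable {Out : ℕ → Type} {S : Type} (start : ℕ → S)
  (rounds : ℕ → ℕ → List (Round S)) (out : (deg : ℕ) → S → (Fin deg → S) → Out deg)
  {V : Type*} [Fintype V] (G : SimpleGraph V) [DecidableRel G.Adj]
  (ident : V → ℕ) (ports : PortNumbering G)

theorem map_ports (x : V → S) (v : V) :
    (Finset.univ : Finset (Fin (G.degree v))).val.map (fun i => x (ports v i)) =
      (G.neighborFinset v).val.map x := by
  have h : G.neighborFinset v = Finset.univ.map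
      ((ports v).toEmbedding.trans (Function.Embedding.subtype _)) := by
    ext u
    simp only [SimpleGraph.mem_neighborFinset, Finset.mem_map, Finset.mem_univ, true_and]
    constructor
    · intro hu
      exact ⟨(ports v).symm ⟨u, hu⟩, by simp⟩
    · rintro ⟨i, rfl⟩
      exact (ports v i).2
  rw [h, Finset.map_val, Multiset.map_map]
  rfl

/-- As Δ ≠ 0, no node terminates during these rounds, so every message arrives and the default of
`getD` is never used. -/
theorem roundAlgorithm_run (hΔ : G.maxDegree ≠ 0) (t : ℕ)
    (ht : t ≤ (rounds (Fintype.card V) G.maxDegree).length) (v : V) :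
    (roundAlgorithm start rounds out).run G ident ports t v =
      ((rounds (Fintype.card V) G.maxDegree).drop t,
        runRounds G ((rounds (Fintype.card V) G.maxDegree).take t) (start ∘ ident) v, none) := by
  induction t generalizing v with
  | zero => simp [LocalAlgorithm.run, roundAlgorithm, hΔ, runRounds]
  | succ t ih =>
    have ht' : t < (rounds (Fintype.card V) G.maxDegree).length := ht
    rw [LocalAlgorithm.run]
    simp only [ih ht'.le]
    rw [List.take_succ_eq_append_getElem ht', runRounds_concat, List.drop_eq_getElem_cons ht']
    simp only [LocalAlgorithm.update, LocalAlgorithm.transmit, roundAlgorithm, Option.map_none,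
      Option.isSome_none, Bool.false_eq_true, if_false, Option.getD_some, applyRound]
    rw [map_ports G ports]

theorem roundAlgorithm_output (hΔ : G.maxDegree ≠ 0) (v : V) :
    (roundAlgorithm start rounds out).output
      ((roundAlgorithm start rounds out).run G ident ports
        ((rounds (Fintype.card V) G.maxDegree).length + 1) v) =
      some (out _ (runRounds G (rounds (Fintype.card V) G.maxDegree) (start ∘ ident) v)
        fun i => runRounds G (rounds (Fintype.card V) G.maxDegree) (start ∘ ident)
          (ports v i)) := by
  rw [LocalAlgorithm.run]
  simp only [roundAlgorithm_run start rounds out G ident ports hΔ _ le_rfl]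
  simp [LocalAlgorithm.update, LocalAlgorithm.transmit, roundAlgorithm]

/-- On a single node, Δ + log* n = 0 and no round may be spent; hence the special start for Δ = 0.
-/
theorem roundAlgorithm_output_zero (hΔ : G.maxDegree = 0) (v : V) :
    (roundAlgorithm start rounds out).output
      ((roundAlgorithm start rounds out).run G ident ports 0 v) =
      some (out _ (start (ident v)) fun _ => start (ident v)) := by
  simp [LocalAlgorithm.run, roundAlgorithm, hΔ]

end RoundAlgorithm

/-! ### Color reduction -/

/-- `x` is a proper coloring of `G` with colors `0, …, m - 1`. -/
def IsProperBelow {V : Type*} (G : SimpleGraph V) (m : ℕ) (x : V → ℕ) : Prop :=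
  (∀ v, x v < m) ∧ ∀ u v, G.Adj u v → x u ≠ x v

/-- In at most `T` rounds, every proper `m`-coloring of every graph of maximum degree at most `Δ`
can be turned into a proper `m'`-coloring. -/
def ColorReduces.{u} (Δ T m m' : ℕ) : Prop :=
  ∃ l : List (Round ℕ), l.length ≤ T ∧
    ∀ (V : Type u) [Fintype V] (G : SimpleGraph V) [DecidableRel G.Adj], G.maxDegree ≤ Δ →
      ∀ x, IsProperBelow G m x → IsProperBelow G m' (runRounds G l x)

universe u

theorem ColorReduces.of_le {Δ T m m' : ℕ} (h : m ≤ m') : ColorReduces.{u} Δ T m m' :=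
  ⟨[], Nat.zero_le _, fun _ _ _ _ _ _ hx => ⟨fun v => (hx.1 v).trans_le h, hx.2⟩⟩

theorem ColorReduces.trans {Δ T T' m m' m'' : ℕ} (h : ColorReduces.{u} Δ T m m')
    (h' : ColorReduces.{u} Δ T' m' m'') : ColorReduces.{u} Δ (T + T') m m'' := by
  obtain ⟨l, hl, H⟩ := h
  obtain ⟨l', hl', H'⟩ := h'
  refine ⟨l ++ l', by simp; omega, fun V _ G _ hG x hx => ?_⟩
  rw [runRounds_append]
  exact H' V G hG _ (H V G hG x hx)

theorem ColorReduces.mono {Δ T T' m m' m₀ m₀' : ℕ} (h : ColorReduces.{u} Δ T m m') (hT : T ≤ T')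
    (hm : m₀ ≤ m) (hm' : m' ≤ m₀') : ColorReduces.{u} Δ T' m₀ m₀' := by
  obtain ⟨l, hl, H⟩ := h
  refine ⟨l, hl.trans hT, fun V _ G _ hG x hx => ?_⟩
  have := H V G hG x ⟨fun v => (hx.1 v).trans_le hm, hx.2⟩
  exact ⟨fun v => (this.1 v).trans_le hm', this.2⟩

/-! ### Linial's color reduction -/

/-- There are `q ^ (k + 1)` polynomials of degree at most `k` over the field with `q` elements,
enough to give each color its own. -/
theorem exists_injOn_degreeLT {q k m : ℕ} [Fact q.Prime] (hm : m ≤ q ^ (k + 1)) :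
    ∃ p : ℕ → Polynomial (ZMod q), (∀ s, (p s).degree < ((k + 1 : ℕ) : WithBot ℕ)) ∧
      Set.InjOn p (Set.Iio m) := by
  have hcard : Fintype.card (Fin m) ≤ Fintype.card (Fin (k + 1) → ZMod q) := by
    simpa [ZMod.card] using hm
  obtain ⟨e⟩ := Function.Embedding.nonempty_of_card_le hcard
  let E := (Polynomial.degreeLTEquiv (ZMod q) (k + 1)).symm
  refine ⟨fun s => if h : s < m then E (e ⟨s, h⟩) else 0, fun s => ?_, ?_⟩
  · dsimp only
    split_ifs with h
    · exact Polynomial.mem_degreeLT.1 (E (e ⟨s, h⟩)).2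
    · simp
  · intro s hs s' hs' h
    simp only [Set.mem_Iio] at hs hs'
    simp only [hs, hs', dif_pos] at h
    simpa using e.injective (E.injective (Subtype.ext h))

/-- Distinct polynomials of degree at most `k` agree in at most `k` points, so at most `Δ * k < q`
points are ruled out. -/
theorem exists_eval_ne {q k Δ : ℕ} [Fact q.Prime] (hq : Δ * k < q) {p : Polynomial (ZMod q)}
    (hp : p.degree < ((k + 1 : ℕ) : WithBot ℕ)) (N : Multiset (Polynomial (ZMod q)))
    (hN : ∀ r ∈ N, r.degree < ((k + 1 : ℕ) : WithBot ℕ) ∧ r ≠ p) (hcard : N.card ≤ Δ) :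
    ∃ y, ∀ r ∈ N, r.eval y ≠ p.eval y := by
  classical
  by_contra! hcon
  have hsub : (Finset.univ : Finset (ZMod q)) ⊆
      N.toFinset.biUnion fun r => (r - p).roots.toFinset := by
    intro y _
    obtain ⟨r, hr, h⟩ := hcon y
    simp only [Finset.mem_biUnion, Multiset.mem_toFinset]
    exact ⟨r, hr, (Polynomial.mem_roots (sub_ne_zero.2 (hN r hr).2)).2 (by simp [h])⟩
  have h1 := Finset.card_le_card hsub
  have h2 : (N.toFinset.biUnion fun r => (r - p).roots.toFinset).card ≤ N.toFinset.card * k := by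
    refine Finset.card_biUnion_le_card_mul _ _ _ fun r hr => ?_
    have hr' := hN r (Multiset.mem_toFinset.1 hr)
    refine (Multiset.toFinset_card_le _).trans ((Polynomial.card_roots' _).trans ?_)
    have hd := (Polynomial.degree_sub_le r p).trans_lt (max_lt hr'.1 hp)
    rw [Polynomial.degree_eq_natDegree (sub_ne_zero.2 hr'.2)] at hd
    have := WithBot.coe_lt_coe.1 hd
    exact Nat.lt_succ_iff.1 this
  rw [Finset.card_univ, ZMod.card] at h1
  have h3 : N.toFinset.card * k ≤ Δ * k :=
    Nat.mul_le_mul_right _ ((Multiset.toFinset_card_le _).trans hcard)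
  omega

theorem mul_add_lt_sq {a b q : ℕ} (ha : a < q) (hb : b < q) : a * q + b < q ^ 2 := by
  nlinarith

/-- Linial's step: a node picks a point `(y, p y)` on the graph of its own polynomial that lies on
no neighbor's graph, and takes `y * q + p y` as its new color. Equal new colors of neighbors would
put that point on both graphs. -/
theorem colorReduces_sq_of_prime {Δ k q m : ℕ} (hp : q.Prime) (hq : Δ * k < q)
    (hm : m ≤ q ^ (k + 1)) : ColorReduces.{u} Δ 1 m (q ^ 2) := by
  classical
  have := Fact.mk hp
  obtain ⟨p, hdeg, hinj⟩ := exists_injOn_degreeLT hm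
  let pick : ℕ → Multiset ℕ → ZMod q := fun s N =>
    Classical.epsilon fun y => ∀ r ∈ N, (p r).eval y ≠ (p s).eval y
  let f : Round ℕ := fun s N => (pick s N).val * q + ((p s).eval (pick s N)).val
  refine ⟨[f], by simp, fun V _ G _ hG x hx => ?_⟩
  have hpick : ∀ v u, G.Adj v u →
      (p (x u)).eval (pick (x v) ((G.neighborFinset v).val.map x)) ≠
        (p (x v)).eval (pick (x v) ((G.neighborFinset v).val.map x)) := by
    intro v u huv
    have hex : ∃ y, ∀ r ∈ (G.neighborFinset v).val.map x, (p r).eval y ≠ (p (x v)).eval y := by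
      obtain ⟨y, hy⟩ := exists_eval_ne hq (hdeg (x v)) ((G.neighborFinset v).val.map (p ∘ x))
        (by
          intro r hr
          simp only [Multiset.mem_map, Finset.mem_val, SimpleGraph.mem_neighborFinset] at hr
          obtain ⟨w, hw, rfl⟩ := hr
          exact ⟨hdeg _, fun h => hx.2 _ _ hw (hinj (hx.1 _) (hx.1 _) h).symm⟩)
        (by simpa using (G.degree_le_maxDegree v).trans hG)
      refine ⟨y, fun r hr => ?_⟩
      obtain ⟨w, hw, rfl⟩ := Multiset.mem_map.1 hr
      exact hy _ (Multiset.mem_map.2 ⟨w, hw, rfl⟩)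
    exact Classical.epsilon_spec hex (x u)
      (Multiset.mem_map_of_mem _ (by simpa using huv))
  refine ⟨fun v => mul_add_lt_sq (ZMod.val_lt _) (ZMod.val_lt _), fun u v huv h => ?_⟩
  have hq0 := hp.pos
  have hdiv := congrArg (· / q) h
  have hmod := congrArg (· % q) h
  simp only [runRounds, List.foldl, applyRound, f, Nat.mul_add_mod,
    Nat.mod_eq_of_lt (ZMod.val_lt _), mul_comm _ q, Nat.mul_add_div hq0,
    Nat.div_eq_of_lt (ZMod.val_lt _), add_zero] at hdiv hmod
  have h1 := ZMod.val_injective q hdiv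
  have h2 := ZMod.val_injective q hmod
  rw [← h1] at h2
  exact hpick u v huv h2.symm

/-! ### The additive-group color reduction -/

/-- A color `z < q ^ 2` stands for the pair `(z / q, z % q)`. A node that sees no neighbor with
its second component drops the first component; other nodes add the first component to the
second one. -/
def additiveGroupRound (q : ℕ) : Round ℕ := fun z N =>
  if ∀ r ∈ N, (r : ZMod q) ≠ z then z % q else z / q * q + (z % q + z / q) % q

section AdditiveGroup

variable {q : ℕ}

theorem additiveGroupRound_lt (hq : 0 < q) {z : ℕ} (hz : z < q ^ 2) (N : Multiset ℕ) :
    additiveGroupRound q z N < q ^ 2 := by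
  have h1 := Nat.mod_lt z hq
  unfold additiveGroupRound
  split_ifs
  · nlinarith
  · exact mul_add_lt_sq (Nat.div_lt_of_lt_mul (by rwa [← sq])) (Nat.mod_lt _ hq)

theorem additiveGroupRound_of_clash (hq : 0 < q) {z : ℕ} {N : Multiset ℕ}
    (h : ¬ ∀ r ∈ N, (r : ZMod q) ≠ z) :
    additiveGroupRound q z N / q = z / q ∧
      (additiveGroupRound q z N : ZMod q) = z + (z / q : ℕ) := by
  rw [additiveGroupRound, if_neg h]
  constructor
  · rw [mul_comm, Nat.mul_add_div hq, Nat.div_eq_of_lt (Nat.mod_lt _ hq), add_zero]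
  · simp

theorem additiveGroupRound_of_not_clash (hq : 0 < q) {z : ℕ} {N : Multiset ℕ}
    (h : ∀ r ∈ N, (r : ZMod q) ≠ z) :
    additiveGroupRound q z N / q = 0 ∧ (additiveGroupRound q z N : ZMod q) = z := by
  rw [additiveGroupRound, if_pos h]
  exact ⟨Nat.div_eq_of_lt (Nat.mod_lt _ hq), by simp⟩

theorem additiveGroupRound_div (hq : 0 < q) (z : ℕ) (N : Multiset ℕ) :
    additiveGroupRound q z N / q = z / q ∨ additiveGroupRound q z N / q = 0 := by
  by_cases h : ∀ r ∈ N, (r : ZMod q) ≠ z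
  · exact Or.inr (additiveGroupRound_of_not_clash hq h).1
  · exact Or.inl (additiveGroupRound_of_clash hq h).1

/-- A node that settles without changing its first component had first component 0, so the addition
rule holds for it too. -/
theorem additiveGroupRound_cast (hq : 0 < q) {z : ℕ} {N : Multiset ℕ}
    (hz : additiveGroupRound q z N / q = z / q) :
    (additiveGroupRound q z N : ZMod q) = z + (z / q : ℕ) := by
  by_cases h : ∀ r ∈ N, (r : ZMod q) ≠ z
  · have := additiveGroupRound_of_not_clash hq h
    rw [this.2, ← hz, this.1]
    simp
  · exact (additiveGroupRound_of_clash hq h).2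

theorem eq_of_div_eq_of_cast_eq {z z' : ℕ} (h : z / q = z' / q) (h' : (z : ZMod q) = z') :
    z = z' := by
  rw [← Nat.div_add_mod z q, ← Nat.div_add_mod z' q, h, (ZMod.natCast_eq_natCast_iff' _ _ _).1 h']

variable {V : Type*} [Fintype V] (G : SimpleGraph V) [DecidableRel G.Adj]

theorem isProperBelow_additiveGroupRound (hq : 0 < q) {x : V → ℕ}
    (hx : IsProperBelow G (q ^ 2) x) :
    IsProperBelow G (q ^ 2) (applyRound G x (additiveGroupRound q)) := by
  refine ⟨fun v => additiveGroupRound_lt hq (hx.1 v) _, ?_⟩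
  -- If a settling `v` and a moving `u` end up equal, then `u` has first component 0 and did not
  -- really move; so `v` clashed with `u` beforehand.
  have mixed : ∀ u v, G.Adj u v →
      (∀ r ∈ (G.neighborFinset v).val.map x, (r : ZMod q) ≠ x v) →
      (¬ ∀ r ∈ (G.neighborFinset u).val.map x, (r : ZMod q) ≠ x u) →
      applyRound G x (additiveGroupRound q) u ≠ applyRound G x (additiveGroupRound q) v := by
    intro u v huv hv hu h
    have hv' := additiveGroupRound_of_not_clash hq hv
    have hu' := additiveGroupRound_of_clash hq hu
    simp only [applyRound] at h
    rw [h, hv'.1, hv'.2] at hu'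
    rw [← hu'.1] at hu'
    refine hv (x u) (Multiset.mem_map_of_mem _ (by simpa using huv.symm)) ?_
    simpa using hu'.2.symm
  intro u v huv
  by_cases hu : ∀ r ∈ (G.neighborFinset u).val.map x, (r : ZMod q) ≠ x u <;>
    by_cases hv : ∀ r ∈ (G.neighborFinset v).val.map x, (r : ZMod q) ≠ x v
  · intro h
    have h' := congrArg (Nat.cast : ℕ → ZMod q) h
    simp only [applyRound] at h'
    rw [(additiveGroupRound_of_not_clash hq hu).2, (additiveGroupRound_of_not_clash hq hv).2] at h'
    exact hv (x u) (Multiset.mem_map_of_mem _ (by simpa using huv.symm)) h'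
  · exact (mixed v u huv.symm hu hv).symm
  · exact mixed u v huv hv hu
  · intro h
    have hu' := additiveGroupRound_of_clash hq hu
    have hv' := additiveGroupRound_of_clash hq hv
    simp only [applyRound] at h
    rw [h, hv'.1, hv'.2] at hu'
    obtain ⟨h1, h2⟩ := hu'
    rw [h1, add_left_inj] at h2
    exact hx.2 u v huv (eq_of_div_eq_of_cast_eq h1.symm h2.symm)

/-- The colors after `t` rounds. -/
def additiveGroupRun (q : ℕ) (x : V → ℕ) (t : ℕ) : V → ℕ :=
  runRounds G (List.replicate t (additiveGroupRound q)) x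

theorem additiveGroupRun_succ (x : V → ℕ) (t : ℕ) (v : V) :
    additiveGroupRun G q x (t + 1) v = additiveGroupRound q (additiveGroupRun G q x t v)
      ((G.neighborFinset v).val.map (additiveGroupRun G q x t)) := by
  rw [additiveGroupRun, List.replicate_succ', runRounds_concat]
  rfl

theorem isProperBelow_additiveGroupRun (hq : 0 < q) {x : V → ℕ}
    (hx : IsProperBelow G (q ^ 2) x) (t : ℕ) :
    IsProperBelow G (q ^ 2) (additiveGroupRun G q x t) := by
  induction t with
  | zero => exact hx
  | succ t ih =>
    rw [additiveGroupRun, List.replicate_succ', runRounds_concat]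
    exact isProperBelow_additiveGroupRound G hq ih

theorem additiveGroupRun_div (hq : 0 < q) (x : V → ℕ) (t s : ℕ) (v : V) :
    additiveGroupRun G q x (t + s) v / q = additiveGroupRun G q x t v / q ∨
      additiveGroupRun G q x (t + s) v / q = 0 := by
  induction s with
  | zero => exact Or.inl rfl
  | succ s ih =>
    rw [← add_assoc, additiveGroupRun_succ]
    rcases additiveGroupRound_div hq (additiveGroupRun G q x (t + s) v)
      ((G.neighborFinset v).val.map (additiveGroupRun G q x (t + s))) with h | h
    · rwa [h]
    · exact Or.inr h

theorem additiveGroupRun_cast (hq : 0 < q) (x : V → ℕ) (t s : ℕ) (v : V)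
    (h : additiveGroupRun G q x (t + s) v / q = additiveGroupRun G q x t v / q) :
    (additiveGroupRun G q x (t + s) v : ZMod q) =
      additiveGroupRun G q x t v + s * (additiveGroupRun G q x t v / q : ℕ) := by
  induction s with
  | zero => simp
  | succ s ih =>
    -- A first component can only change to 0 and then stays 0, so equal values at both ends force
    -- equality in between.
    have h0 : additiveGroupRun G q x (t + s) v / q = additiveGroupRun G q x t v / q := by
      rcases additiveGroupRun_div G hq x t s v with h' | h'
      · exact h'
      · rcases additiveGroupRun_div G hq x (t + s) 1 v with h'' | h''
        · rw [← h'', ← h, add_assoc]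
        · rw [h', ← h, ← add_assoc, h'']
    rw [← add_assoc, additiveGroupRun_succ] at h ⊢
    rw [additiveGroupRound_cast hq (h.trans h0.symm), ih h0, h0]
    push_cast
    ring

/-- A node unsettled after `q` rounds clashed with a neighbor in each of them. Each neighbor
accounts for at most two clashes, one with nonzero and one with zero first component: two clashes of
the same kind, fewer than `q` rounds apart, would force equal first components modulo the prime `q`,
hence equal colors. But `q` exceeds 2Δ. -/
theorem additiveGroupRun_lt (hq : q.Prime) (hΔ : 2 * G.maxDegree < q) {x : V → ℕ}
    (hx : IsProperBelow G (q ^ 2) x) (v : V) : additiveGroupRun G q x q v < q := by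
  classical
  have := Fact.mk hq
  have hq0 := hq.pos
  by_contra! hcon
  have hpos : additiveGroupRun G q x q v / q ≠ 0 := (Nat.div_pos hcon hq0).ne'
  have hv : ∀ t ≤ q, additiveGroupRun G q x t v / q = additiveGroupRun G q x q v / q := by
    intro t ht
    have h := additiveGroupRun_div G hq0 x t (q - t) v
    rw [Nat.add_sub_cancel' ht] at h
    exact (h.resolve_right hpos).symm
  have hclash : ∀ t, ∃ u, t < q → G.Adj v u ∧
      (additiveGroupRun G q x t u : ZMod q) = additiveGroupRun G q x t v := by
    intro t
    by_cases ht : t < q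
    · by_contra! hno
      refine hpos ?_
      rw [← hv (t + 1) ht, additiveGroupRun_succ]
      refine (additiveGroupRound_of_not_clash hq0 fun r hr => ?_).1
      obtain ⟨u, hu, rfl⟩ := Multiset.mem_map.1 hr
      exact (hno u).2 (by simpa using hu)
    · exact ⟨v, fun h => absurd h ht⟩
  choose u hu using hclash
  have key : ∀ t t', t < t' → t' < q → u t = u t' →
      decide (additiveGroupRun G q x t (u t) / q = 0) =
        decide (additiveGroupRun G q x t' (u t') / q = 0) → False := by
    intro t t' htt ht' hut hdec
    obtain ⟨s, rfl⟩ := Nat.exists_eq_add_of_lt htt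
    rw [add_assoc] at *
    obtain ⟨hadj, h1⟩ := hu t (by omega)
    obtain ⟨-, h2⟩ := hu (t + (s + 1)) ht'
    rw [← hut] at h2 hdec
    rw [decide_eq_decide] at hdec
    have hdiv : additiveGroupRun G q x (t + (s + 1)) (u t) / q =
        additiveGroupRun G q x t (u t) / q := by
      rcases additiveGroupRun_div G hq0 x t (s + 1) (u t) with h | h
      · exact h
      · rw [h, hdec.2 h]
    rw [additiveGroupRun_cast G hq0 x _ _ _ hdiv,
      additiveGroupRun_cast G hq0 x _ _ v ((hv _ ht'.le).trans (hv t (by omega)).symm), h1,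
      add_right_inj] at h2
    have hs : ((s + 1 : ℕ) : ZMod q) ≠ 0 := by
      rw [Ne, ZMod.natCast_eq_zero_iff]
      exact Nat.not_dvd_of_pos_of_lt (Nat.succ_pos _) (by omega)
    have h3 := mul_left_cancel₀ hs h2
    have hlt := fun w => Nat.div_lt_of_lt_mul
      (((isProperBelow_additiveGroupRun G hq0 hx t).1 w).trans_eq (sq q))
    rw [ZMod.natCast_eq_natCast_iff', Nat.mod_eq_of_lt (hlt _), Nat.mod_eq_of_lt (hlt _)] at h3
    exact (isProperBelow_additiveGroupRun G hq0 hx t).2 _ _ hadj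
      (eq_of_div_eq_of_cast_eq h3 h1).symm
  obtain ⟨t, ht, t', ht', hne, heq⟩ := Finset.exists_ne_map_eq_of_card_lt_of_maps_to
    (s := Finset.range q) (t := G.neighborFinset v ×ˢ (Finset.univ : Finset Bool))
    (f := fun t => (u t, decide (additiveGroupRun G q x t (u t) / q = 0)))
    (by
      have := G.degree_le_maxDegree v
      simp only [Finset.card_product, SimpleGraph.card_neighborFinset_eq_degree,
        Finset.card_univ, Fintype.card_bool, Finset.card_range]
      omega)
    (by
      intro t ht
      have ht := Finset.mem_range.1 ht
      exact Finset.mem_product.2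
        ⟨(G.mem_neighborFinset v _).2 (hu t ht).1, Finset.mem_univ _⟩)
  rw [Finset.mem_range] at ht ht'
  simp only [Prod.mk.injEq] at heq
  rcases hne.lt_or_gt with h | h
  · exact key t t' h ht' heq.1 heq.2
  · exact key t' t h ht heq.1.symm heq.2.symm

end AdditiveGroup

theorem colorReduces_of_sq {Δ q : ℕ} (hp : q.Prime) (hq : 2 * Δ < q) :
    ColorReduces.{u} Δ q (q ^ 2) q := by
  refine ⟨List.replicate q (additiveGroupRound q), by simp, fun V _ G _ hG x hx => ⟨?_, ?_⟩⟩
  · exact additiveGroupRun_lt G hp (by omega) hx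
  · exact (isProperBelow_additiveGroupRun G hp.pos hx q).2

/-! ### The number of rounds -/

theorem colorReduces_two_pow {Δ k : ℕ} (hΔ : Δ ≠ 0) (hk : k ≠ 0) :
    ColorReduces.{u} Δ 1 (2 ^ k) ((2 * (Δ * k)) ^ 2) := by
  -- Bertrand's postulate; `2 ^ k ≤ q ^ (k + 1)` holds for any prime.
  obtain ⟨q, hq, hlt, hle⟩ := Nat.exists_prime_lt_and_le_two_mul (Δ * k) (mul_ne_zero hΔ hk)
  refine (colorReduces_sq_of_prime hq hlt ?_).mono le_rfl le_rfl (Nat.pow_le_pow_left hle 2)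
  exact (Nat.pow_le_pow_right (by norm_num) (Nat.le_succ k)).trans
    (Nat.pow_le_pow_left hq.two_le _)

theorem four_mul_pow_clog_le {A : ℕ} (hA : 2 ^ 32 ≤ A) : 4 * (2 + 4 * Nat.clog 2 A) ^ 4 ≤ A := by
  have key : ∀ s, 31 ≤ s → 4 * (2 + 4 * (s + 1)) ^ 4 ≤ 2 ^ s := by
    intro s hs
    induction s, hs using Nat.le_induction with
    | base => norm_num
    | succ s hs ih =>
      have h : (2 + 4 * (s + 1 + 1)) ^ 4 ≤ 2 * (2 + 4 * (s + 1)) ^ 4 := by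
        obtain ⟨r, rfl⟩ := Nat.exists_eq_add_of_le hs
        ring_nf
        nlinarith [Nat.zero_le (r ^ 2), Nat.zero_le (r ^ 3), Nat.zero_le (r ^ 4)]
      rw [pow_succ 2]
      omega
  have hlt : 31 < Nat.clog 2 A := by
    rw [Nat.lt_clog_iff_pow_lt (by norm_num)]
    exact lt_of_lt_of_le (by norm_num) hA
  obtain ⟨s, hs⟩ := Nat.exists_eq_add_of_lt hlt
  have h2 : 2 ^ (31 + s) < A := by
    rw [← Nat.lt_clog_iff_pow_lt (by norm_num)]
    omega
  rw [hs]
  exact (key (31 + s) (by omega)).trans h2.le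

/-- Either `k` dominates Δ and the bound is polynomial in `k` alone, or the target `(10 * Δ) ^ 11`
is already reached. -/
theorem sq_two_mul_mul_le (Δ k : ℕ) (hΔ : Δ ≠ 0) :
    (2 * (Δ * k)) ^ 2 ≤ max (4 * k ^ 4) ((10 * Δ) ^ 11) := by
  rcases le_total Δ k with h | h
  · refine le_max_of_le_left ?_
    calc (2 * (Δ * k)) ^ 2 ≤ (2 * (k * k)) ^ 2 := by gcongr
      _ = 4 * k ^ 4 := by ring
  · refine le_max_of_le_right ?_
    calc (2 * (Δ * k)) ^ 2 ≤ (2 * (Δ * Δ)) ^ 2 := by gcongr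
      _ = 4 * Δ ^ 4 := by ring
      _ ≤ 10 ^ 11 * Δ ^ 11 := Nat.mul_le_mul (by norm_num)
          (Nat.pow_le_pow_right (Nat.pos_of_ne_zero hΔ) (by norm_num))
      _ = (10 * Δ) ^ 11 := by ring

/-- One step only reaches `4 * A ^ 4`; a second one makes this polylogarithmic in `A`, which is
below `A` from `2 ^ 32` on. -/
theorem colorReduces_log {Δ A : ℕ} (hΔ : Δ ≠ 0) (hA : 2 ^ 32 ≤ A) :
    ColorReduces.{u} Δ 2 (2 ^ A) (max A ((10 * Δ) ^ 11)) := by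
  have h1 := (colorReduces_two_pow.{u} hΔ (by positivity : A ≠ 0)).mono le_rfl le_rfl
    (sq_two_mul_mul_le Δ A hΔ)
  refine h1.trans (T' := 1) ?_
  rcases le_total (4 * A ^ 4) ((10 * Δ) ^ 11) with h | h
  · rw [max_eq_right h]
    exact (ColorReduces.of_le le_rfl).mono zero_le_one le_rfl (le_max_right _ _)
  · rw [max_eq_left h]
    refine (colorReduces_two_pow hΔ (by omega : 2 + 4 * Nat.clog 2 A ≠ 0)).mono le_rfl ?_
      ((sq_two_mul_mul_le Δ _ hΔ).trans (max_le_max_right _ (four_mul_pow_clog_le hA)))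
    calc 4 * A ^ 4 ≤ 4 * (2 ^ Nat.clog 2 A) ^ 4 := by
          gcongr; exact Nat.le_pow_clog (by norm_num) _
      _ = 2 ^ (2 + 4 * Nat.clog 2 A) := by rw [pow_add, mul_comm 4 (Nat.clog 2 A), pow_mul]; norm_num

/-! ### Towers of twos and log* -/

/-- A tower of twos of height `j`, on top of which stands `b`. -/
def towerAbove (b : ℕ) : ℕ → ℕ
  | 0 => b
  | j + 1 => 2 ^ towerAbove b j

theorem add_le_towerAbove (b j : ℕ) : b + j ≤ towerAbove b j := by
  induction j with
  | zero => exact le_rfl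
  | succ j ih => exact ih.trans_lt Nat.lt_two_pow_self

theorem colorReduces_towerAbove {Δ : ℕ} (hΔ : Δ ≠ 0) (j : ℕ) :
    ColorReduces.{u} Δ (2 * j) (towerAbove (2 ^ 32) j) ((10 * Δ) ^ 11) := by
  induction j with
  | zero =>
    refine ColorReduces.of_le ?_
    calc towerAbove (2 ^ 32) 0 ≤ 10 ^ 11 := by rw [towerAbove]; norm_num
      _ ≤ (10 * Δ) ^ 11 := Nat.pow_le_pow_left (by omega) _
  | succ j ih =>
    have h := colorReduces_log.{u} hΔ ((Nat.le_add_right _ j).trans (add_le_towerAbove _ _))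
    refine (h.trans (T' := 2 * j) ?_).mono (by omega) le_rfl le_rfl
    rcases le_total (towerAbove (2 ^ 32) j) ((10 * Δ) ^ 11) with h' | h'
    · rw [max_eq_right h']
      exact (ColorReduces.of_le le_rfl).mono (Nat.zero_le _) le_rfl le_rfl
    · rwa [max_eq_left h']

theorem colorReduces_linear {Δ : ℕ} (hΔ : Δ ≠ 0) (j : ℕ) :
    ColorReduces.{u} Δ (2 * j + 1 + 20 * Δ) (towerAbove (2 ^ 32) j) (20 * Δ) := by
  obtain ⟨q, hq, hlt, hle⟩ := Nat.exists_prime_lt_and_le_two_mul (10 * Δ) (by omega)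
  -- Degree `k = 10` fits `q > 10 * Δ`, and `q ^ (k + 1)` exceeds `(10 * Δ) ^ 11`; this is where the
  -- exponent 11 comes from.
  have h1 := colorReduces_sq_of_prime.{u} (Δ := Δ) (k := 10) hq (by omega)
    (Nat.pow_le_pow_left hlt.le 11)
  have h2 := colorReduces_of_sq.{u} (Δ := Δ) hq (by omega)
  exact (((colorReduces_towerAbove hΔ j).trans h1).trans h2).mono (by omega) le_rfl (by omega)

theorem le_towerAbove_of_iterate_logb_le (k : ℕ) (y : ℝ) (h : (Real.logb 2)^[k] y ≤ 1) :
    y ≤ towerAbove 1 k := by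
  induction k generalizing y with
  | zero => simpa [towerAbove] using h
  | succ k ih =>
    rw [Function.iterate_succ_apply] at h
    rcases le_or_gt y 0 with hy | hy
    -- For `y ≤ 0` the value of `logb` is meaningless, but the tower is nonnegative anyway.
    · exact hy.trans (Nat.cast_nonneg _)
    · have := (Real.logb_le_iff_le_rpow (by norm_num) hy).1 (ih _ h)
      rw [Real.rpow_natCast] at this
      exact_mod_cast this

theorem le_towerAbove_logStar (n : ℕ) : n ≤ towerAbove 1 (logStar n) := by
  exact_mod_cast le_towerAbove_of_iterate_logb_le _ _ (Nat.sInf_mem (logStar_set_nonempty n))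

/-- A constant factor `D` is absorbed by `D` extra levels, which cost only O(D) rounds. -/
theorem mul_towerAbove_le (D j : ℕ) : D * towerAbove 1 j ≤ towerAbove (2 ^ 32) (j + D) := by
  rcases Nat.eq_zero_or_pos D with rfl | hD
  · simp
  induction j with
  | zero =>
    have := add_le_towerAbove (2 ^ 32) D
    simp only [towerAbove, mul_one, zero_add]
    omega
  | succ j ih =>
    rw [Nat.add_right_comm, towerAbove, towerAbove]
    refine le_trans ?_ (Nat.pow_le_pow_right (by norm_num) ih)
    obtain ⟨D, rfl⟩ := Nat.exists_eq_add_of_lt hD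
    have h1 : 1 ≤ towerAbove 1 j := (Nat.le_add_right 1 j).trans (add_le_towerAbove 1 j)
    have h2 : 0 + D + 1 ≤ 2 ^ D := by simpa using Nat.lt_two_pow_self (n := D)
    calc (0 + D + 1) * 2 ^ towerAbove 1 j ≤ 2 ^ D * 2 ^ towerAbove 1 j := by gcongr
      _ = 2 ^ (D + towerAbove 1 j) := (pow_add _ _ _).symm
      _ ≤ 2 ^ ((0 + D + 1) * towerAbove 1 j) :=
          Nat.pow_le_pow_right (by norm_num) (by nlinarith)

theorem exists_eval_lt_two_pow (P : Polynomial ℕ) :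
    ∃ D, ∀ n, 2 ≤ n → P.eval n < 2 ^ (D * n) := by
  -- `P.eval 1` is the sum of the coefficients, so `P.eval n ≤ P.eval 1 * n ^ P.natDegree`.
  refine ⟨P.eval 1 + P.natDegree, fun n hn => ?_⟩
  have h1 : P.eval n ≤ P.eval 1 * n ^ P.natDegree := by
    rw [Polynomial.eval_eq_sum_range, Polynomial.eval_eq_sum_range, Finset.sum_mul]
    refine Finset.sum_le_sum fun i hi => ?_
    rw [one_pow, mul_one]
    exact Nat.mul_le_mul_left _
      (Nat.pow_le_pow_right (by omega) (Nat.lt_succ_iff.1 (Finset.mem_range.1 hi)))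
  calc P.eval n ≤ P.eval 1 * n ^ P.natDegree := h1
    _ < 2 ^ P.eval 1 * (2 ^ n) ^ P.natDegree :=
        Nat.mul_lt_mul_of_lt_of_le Nat.lt_two_pow_self
          (Nat.pow_le_pow_left Nat.lt_two_pow_self.le _) (by positivity)
    _ = 2 ^ (P.eval 1 + n * P.natDegree) := by rw [pow_add, pow_mul]
    _ ≤ 2 ^ ((P.eval 1 + P.natDegree) * n) :=
        Nat.pow_le_pow_right (by norm_num) (by nlinarith)

/-- Identifiers from a polynomial range can be turned into `O(Δ)` colors in `O(Δ + log* n)`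
rounds. -/
theorem exists_colorReduces_of_polynomial (P : Polynomial ℕ) :
    ∃ D : ℕ, ∀ n Δ : ℕ, 2 ≤ n → Δ ≠ 0 →
      ColorReduces.{u} Δ (D * (Δ + logStar n)) (P.eval n + 1) (20 * Δ) := by
  obtain ⟨D, hD⟩ := exists_eval_lt_two_pow P
  refine ⟨2 * D + 23, fun n Δ hn hΔ => ?_⟩
  -- The extra level turns the bound on `D * n` into one on `2 ^ (D * n)`. Since Δ ≥ 1, the additive
  -- constant `2 * D + 3` fits into the budget.
  refine (colorReduces_linear hΔ (logStar n + D + 1)).mono ?_ ?_ le_rfl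
  · have : 1 ≤ Δ := Nat.pos_of_ne_zero hΔ
    nlinarith [Nat.zero_le (D * logStar n)]
  · refine (hD n hn).trans_le (Nat.pow_le_pow_right (by norm_num) ?_)
    exact (Nat.mul_le_mul_left D (le_towerAbove_logStar n)).trans (mul_towerAbove_le D _)

/-! ### Greedy arbdefective coloring -/

section Greedy

variable {c : ℕ} (d : Fin (c + 1) → ℕ)

/-- The nodes of color `s` choose an arbdefect color that few neighbors of smaller color have. -/
noncomputable def greedyRound (s : ℕ) : Round (ℕ × Fin (c + 1)) := fun z N =>
  if z.1 = s then
    (z.1, Classical.epsilon fun i => N.countP (fun r => r.1 < s ∧ r.2 = i) ≤ d i)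
  else z

/-- Pigeonhole: otherwise the color classes in `N` would have at least `d i + 1` elements each,
together at least the capacity. -/
theorem exists_card_filter_le {V : Type*} (N : Finset V) (hN : N.card < arbdefectCapacity d)
    (p : V → Prop) [DecidablePred p] (f : V → Fin (c + 1)) :
    ∃ i, (N.filter fun u => p u ∧ f u = i).card ≤ d i := by
  by_contra! h
  have h1 : arbdefectCapacity d ≤ ∑ i, (N.filter fun u => p u ∧ f u = i).card :=
    Finset.sum_le_sum fun i _ => h i
  have h2 : ∑ i, (N.filter fun u => p u ∧ f u = i).card ≤
      ∑ i, (N.filter fun u => f u = i).card :=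
    Finset.sum_le_sum fun i _ => Finset.card_le_card fun u hu => by
      simp only [Finset.mem_filter] at hu ⊢
      exact ⟨hu.1, hu.2.2⟩
  have h3 := Finset.card_eq_sum_card_fiberwise (f := f) (s := N) (t := Finset.univ)
    (fun _ _ => Finset.mem_coe.2 (Finset.mem_univ _))
  omega

variable {V : Type*} [Fintype V] (G : SimpleGraph V) [DecidableRel G.Adj]

/-- The states after the greedy rounds `0, …, t - 1`. -/
noncomputable def greedyRun (z : V → ℕ × Fin (c + 1)) (t : ℕ) : V → ℕ × Fin (c + 1) :=
  runRounds G ((List.range t).map (greedyRound d)) z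

theorem greedyRun_succ (z : V → ℕ × Fin (c + 1)) (t : ℕ) (v : V) :
    greedyRun d G z (t + 1) v = greedyRound d t (greedyRun d G z t v)
      ((G.neighborFinset v).val.map (greedyRun d G z t)) := by
  rw [greedyRun, List.range_succ, List.map_append, List.map_singleton, runRounds_concat]
  rfl

theorem greedyRun_fst (z : V → ℕ × Fin (c + 1)) (t : ℕ) (v : V) :
    (greedyRun d G z t v).1 = (z v).1 := by
  induction t with
  | zero => rfl
  | succ t ih =>
    rw [greedyRun_succ, greedyRound]
    split_ifs <;> exact ih

theorem greedyRun_succ_of_ne (z : V → ℕ × Fin (c + 1)) {t : ℕ} {v : V} (h : (z v).1 ≠ t) :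
    greedyRun d G z (t + 1) v = greedyRun d G z t v := by
  rw [greedyRun_succ, greedyRound, if_neg (by rwa [greedyRun_fst])]

/-- In the round in which `v` chooses, its neighbors of smaller color have already chosen;
afterwards neither they nor `v` change. -/
theorem greedyRun_card_le (hd : G.maxDegree < arbdefectCapacity d) (z : V → ℕ × Fin (c + 1))
    (t : ℕ) (v : V) (hv : (z v).1 < t) :
    ((G.neighborFinset v).filter fun u => (z u).1 < (z v).1 ∧
      (greedyRun d G z t u).2 = (greedyRun d G z t v).2).card ≤ d (greedyRun d G z t v).2 := by
  induction t with
  | zero => exact absurd hv (Nat.not_lt_zero _)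
  | succ t ih =>
    have hsmall : ∀ u, (z u).1 < (z v).1 → greedyRun d G z (t + 1) u = greedyRun d G z t u :=
      fun u hu => greedyRun_succ_of_ne d G z (by omega)
    have hfilter : ∀ i, ((G.neighborFinset v).filter fun u => (z u).1 < (z v).1 ∧
        (greedyRun d G z (t + 1) u).2 = i) = (G.neighborFinset v).filter fun u =>
          (z u).1 < (z v).1 ∧ (greedyRun d G z t u).2 = i :=
      fun i => Finset.filter_congr fun u _ => and_congr_right fun hu => by rw [hsmall u hu]
    rw [hfilter]
    rcases Nat.lt_succ_iff_lt_or_eq.1 hv with h | h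
    · rw [greedyRun_succ_of_ne d G z h.ne]
      exact ih h
    · have hex := exists_card_filter_le d (G.neighborFinset v)
        ((G.degree_le_maxDegree v).trans_lt hd) (fun u => (z u).1 < (z v).1)
        (fun u => (greedyRun d G z t u).2)
      have hcount : ∀ i, ((G.neighborFinset v).val.map (greedyRun d G z t)).countP
          (fun r => r.1 < t ∧ r.2 = i) = ((G.neighborFinset v).filter fun u =>
            (z u).1 < (z v).1 ∧ (greedyRun d G z t u).2 = i).card := by
        intro i
        rw [Multiset.countP_map, Finset.card_def, Finset.filter_val]
        simp only [greedyRun_fst, h]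
      rw [greedyRun_succ, greedyRound, if_pos (by rw [greedyRun_fst, h])]
      simp only [hcount]
      exact Classical.epsilon_spec hex

end Greedy

/-! ### Orientation, output and the final algorithm -/

/-- The orientation of the edges towards the endpoint of smaller color. -/
def orientationOfColoring {V : Type*} {G : SimpleGraph V} {x : V → ℕ}
    (hx : ∀ u v, G.Adj u v → x u ≠ x v) : EdgeOrientation G where
  Out u v := G.Adj u v ∧ x v < x u
  adj_of_out h := h.1
  xor_of_adj {u v} h := by
    rcases (hx u v h).lt_or_gt with h' | h'
    · exact Or.inr ⟨⟨h.symm, h'⟩, fun h'' => h'.asymm h''.2⟩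
    · exact Or.inl ⟨⟨h, h'⟩, fun h'' => h'.asymm h''.2⟩

theorem isArbdefectiveSolution_of_maxDegree_eq_zero {V : Type*} [Fintype V] (G : SimpleGraph V)
    [DecidableRel G.Adj] (ports : PortNumbering G) {c : ℕ} (d : Fin c → ℕ)
    (out : (v : V) → ArbdefectiveOutput c (G.degree v)) (hG : G.maxDegree = 0) :
    IsArbdefectiveSolution G ports d out := by
  have hdeg : ∀ v, G.degree v = 0 := fun v =>
    Nat.eq_zero_of_le_zero (hG ▸ G.degree_le_maxDegree v)
  have hadj : ∀ u v, ¬ G.Adj u v := fun u v h =>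
    (G.degree_pos_iff_exists_adj u |>.2 ⟨v, h⟩).ne' (hdeg u)
  refine ⟨orientationOfColoring (x := fun _ => 0) fun u v h => absurd h (hadj u v),
    fun v i => (Fin.cast (hdeg v) i).elim0, fun v => ?_⟩
  have : {u : V | (orientationOfColoring (x := fun _ => 0) fun u v h =>
      absurd h (hadj u v)).Out v u ∧ (out u).color = (out v).color} = ∅ := by
    ext u
    simp [orientationOfColoring]
  rw [this]
  simp

/-- The output of a node from its own state and those of its neighbors: edges are directed
towards smaller colors. -/
def greedyOutput {c : ℕ} (deg : ℕ) (s : ℕ × Fin c) (N : Fin deg → ℕ × Fin c) :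
    ArbdefectiveOutput c deg where
  color := s.2
  outgoing i := decide ((N i).1 < s.1)

theorem isArbdefectiveSolution_greedy {V : Type*} [Fintype V] (G : SimpleGraph V)
    [DecidableRel G.Adj] (ports : PortNumbering G) {c : ℕ} (d : Fin (c + 1) → ℕ)
    (hd : G.maxDegree < arbdefectCapacity d) {m : ℕ} (z : V → ℕ × Fin (c + 1))
    (hz : IsProperBelow G m (Prod.fst ∘ z)) :
    IsArbdefectiveSolution G ports d fun v =>
      greedyOutput (G.degree v) (greedyRun d G z m v) fun i => greedyRun d G z m (ports v i) := by
  refine ⟨orientationOfColoring hz.2, fun v i => ?_, fun v => ?_⟩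
  · have hadj : G.Adj v (ports v i) := (ports v i).2
    simp [greedyOutput, orientationOfColoring, greedyRun_fst, hadj]
  · refine le_of_eq_of_le ?_ (greedyRun_card_le d G hd z m v (hz.1 v))
    rw [← Set.ncard_coe_finset]
    congr 1
    ext u
    simp [greedyOutput, orientationOfColoring, and_assoc]

theorem mainTheorem10 (P : Polynomial ℕ) :
    ∃ K : ℕ, ∀ (c : ℕ) (d : Fin c → ℕ),
      ∃ A : LocalAlgorithm (ArbdefectiveOutput c),
        ∀ (V : Type*) [Fintype V] (G : SimpleGraph V) [DecidableRel G.Adj],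
          IsRelaxed 1 G.maxDegree d →
          ∀ (ident : V → ℕ) (ports : PortNumbering G),
            IsIdentAssignment (P.eval (Fintype.card V)) ident →
            A.SolvesWithin G ident ports (IsArbdefectiveSolution G ports d)
              (K * (G.maxDegree + logStar (Fintype.card V))) := by
  classical
  obtain ⟨D, hD⟩ := exists_colorReduces_of_polynomial P
  choose! l hlen hl using hD
  -- `20 * Δ` greedy rounds and one final exchange add at most `21 * Δ`.
  refine ⟨D + 21, fun c d => ?_⟩
  cases c with
  | zero =>
    refine ⟨⟨fun _ => Unit, Unit, fun _ _ _ _ => (), fun _ _ => (), fun _ _ => (),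
      fun _ => none⟩, fun V _ G _ hrel => ?_⟩
    simp only [IsRelaxed, arbdefectCapacity, Finset.univ_eq_empty, Finset.sum_empty,
      Nat.cast_zero, one_mul] at hrel
    exact absurd hrel (Nat.cast_nonneg _).not_gt
  | succ c =>
    let rounds : ℕ → ℕ → List (Round (ℕ × Fin (c + 1))) := fun n Δ =>
      (l n Δ).map Round.onFst ++ (List.range (20 * Δ)).map (greedyRound d)
    -- The initial arbdefect color 0 is a dummy: only neighbors that have already chosen are
    -- counted.
    refine ⟨roundAlgorithm (fun i => (i, 0)) rounds greedyOutput,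
      fun V _ G _ hrel ident ports hid => ?_⟩
    have hd : G.maxDegree < arbdefectCapacity d := by
      simpa [IsRelaxed] using hrel
    by_cases hΔ : G.maxDegree = 0
    · exact ⟨_, fun v => LocalAlgorithm.output_run_of_le _ G ident ports (Nat.zero_le _)
        (roundAlgorithm_output_zero _ rounds greedyOutput G ident ports hΔ v),
        isArbdefectiveSolution_of_maxDegree_eq_zero G ports d _ hΔ⟩
    have hn : 2 ≤ Fintype.card V := by
      by_contra! hn
      have : Subsingleton V := Fintype.card_le_one_iff_subsingleton.1 (by omega)
      refine hΔ (Nat.eq_zero_of_le_zero (G.maxDegree_le_of_forall_degree_le 0 fun v => ?_))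
      by_contra! hv
      obtain ⟨u, hu⟩ := (G.degree_pos_iff_exists_adj v).1 hv
      exact hu.ne (Subsingleton.elim _ _)
    refine ⟨_, fun v => LocalAlgorithm.output_run_of_le _ G ident ports ?_
      (roundAlgorithm_output _ rounds greedyOutput G ident ports hΔ v), ?_⟩
    · have h1 := hlen _ _ hn hΔ
      simp only [rounds, List.length_append, List.length_map, List.length_range]
      rw [add_mul]
      have := Nat.pos_of_ne_zero hΔ
      omega
    · simp only [rounds, runRounds_append]
      refine isArbdefectiveSolution_greedy G ports d hd _ ?_
      rw [runRounds_onFst]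
      -- Identifiers up to `P.eval n` are colors below `P.eval n + 1`.
      exact hl _ _ hn hΔ V G le_rfl _ ⟨fun v => Nat.lt_succ_of_le (hid.2 v).2,
        fun u v huv h => huv.ne (hid.1 h)⟩
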